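/- Let $ABC$ be a nondegenerate triangle in the Euclidean plane. For a point $P$ on its circumcircle, $P\neq A,B,C$, let the P-ellipses $\mathcal{E}_a^*,\mathcal{E}_b^*,\mathcal{E}_c^*$ be the ellipses through $P$ with foci $(B,C)$, $(C,A)$, $(A,B)$, respectively, and let the V-ellipses $\mathcal{E}_a,\mathcal{E}_b,\mathcal{E}_c$ be the ellipses with foci $(B,C)$, $(C,A)$, $(A,B)$ passing through $A$, $B$, $C$, respectively. The vertices of such an ellipse are its two intersections with the line through its foci. Then, for every such $P$, there is exactly one conic $\mathcal{Y}^*$ passing through the six vertices of the three P-ellipses; it is degenerate, namely a union of two distinct straight lines, and it has exactly one center (of symmetry) $O^*$. Moreover, as $P$ moves over the circumcircle minus $\{A,B,C\}$, the locus of $O^*$ is the union of three arcs (without their endpoints), one on each of three distinct ellipses $\mathcal{L}_a,\mathcal{L}_b,\mathcal{L}_c$, each of which passes through the midpoints of the three sides of $ABC$. The two endpoints of the arc on $\mathcal{L}_a$ are one vertex of $\mathcal{E}_b$ and one vertex of $\mathcal{E}_c$, those of the arc on $\mathcal{L}_b$ are one vertex of $\mathcal{E}_c$ and one of $\mathcal{E}_a$,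 and those of the arc on $\mathcal{L}_c$ are one vertex of $\mathcal{E}_a$ and one of $\mathcal{E}_b$. -/

import Mathlib

noncomputable section

namespace ConicTriad

/-- The Euclidean plane. -/
abbrev Plane := EuclideanSpace ℝ (Fin 2)

/-- The locus of points whose distances to `F` and `G` have sum `s`. -/
def focalLocus (F G : Plane) (s : ℝ) : Set Plane :=
  {X | dist X F + dist X G = s}

/-- A (nondegenerate) ellipse, given by two foci and a sum of distances. Circles are included. -/
def IsEllipse (E : Set Plane) : Prop :=
  ∃ (F G : Plane) (s : ℝ), dist F G < s ∧ E = focalLocus F G s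

/-- The ellipse with foci `F`, `G` passing through `P` (nondegenerate if `P` is not on the
segment `FG`). -/
def ellipseThrough (F G P : Plane) : Set Plane :=
  focalLocus F G (dist P F + dist P G)

/-- The vertices of the ellipse with foci `F ≠ G` through `P`: its intersections with the
focal axis. -/
def vertices (F G P : Plane) : Set Plane :=
  ellipseThrough F G P ∩ (line[ℝ, F, G] : Set Plane)

/-- The vertices of the `i`-th V-ellipse of the triangle `T`: its foci are the two vertices of `T`
other than the `i`-th one, and it passes through the `i`-th one. -/
def vEllipseVertices (T : Affine.Triangle ℝ Plane) (i : Fin 3) : Set Plane :=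
  vertices (T.points (i + 1)) (T.points (i + 2)) (T.points i)

/-- The vertices of the `i`-th P-ellipse of the triangle `T`: its foci are the two vertices of `T`
other than the `i`-th one, and it passes through `P`. -/
def pEllipseVertices (T : Affine.Triangle ℝ Plane) (P : Plane) (i : Fin 3) : Set Plane :=
  vertices (T.points (i + 1)) (T.points (i + 2)) P

/-- A (possibly degenerate) conic: the zero set of a polynomial of degree exactly two. -/
def IsConic (Y : Set Plane) : Prop :=
  ∃ a b c d e f : ℝ, ¬ (a = 0 ∧ b = 0 ∧ c = 0) ∧
    Y = {X | a * X 0 ^ 2 + b * X 0 * X 1 + c * X 1 ^ 2 + d * X 0 + e * X 1 + f = 0}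

/-- The conic is degenerate: it is the union of two distinct straight lines. -/
def IsLinePair (Y : Set Plane) : Prop :=
  ∃ l m : AffineSubspace ℝ Plane, Module.finrank ℝ l.direction = 1 ∧
    Module.finrank ℝ m.direction = 1 ∧ l ≠ m ∧ Y = (l : Set Plane) ∪ (m : Set Plane)

/-- `O` is a center (of symmetry) of `Y`. -/
def IsCenter (Y : Set Plane) (O : Plane) : Prop :=
  ∀ X ∈ Y, AffineEquiv.pointReflection ℝ O X ∈ Y

/-- `Y` is a conic through the six vertices of the three P-ellipses of the triangle `T`. -/
def IsSixPointConic (T : Affine.Triangle ℝ Plane) (P : Plane) (Y : Set Plane) : Prop :=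
  IsConic Y ∧ ∀ i : Fin 3, pEllipseVertices T P i ⊆ Y

/-- The points of the circumcircle that are not vertices of the triangle (at a vertex of the
triangle, two of the P-ellipses collapse to segments). -/
def admissible (T : Affine.Triangle ℝ Plane) : Set Plane :=
  {P | P ∈ T.circumsphere ∧ P ∉ Set.range T.points}

/-- The locus of the center of the six-point conic as `P` moves on the circumcircle. -/
def centerLocus (T : Affine.Triangle ℝ Plane) : Set Plane :=
  {O | ∃ P ∈ admissible T, ∃ Y, IsSixPointConic T P Y ∧ IsCenter Y O}

/-- `Γ` is an arc of the curve `E` with the (distinct) endpoints `U`, `W`, which belong to `E`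
and are not counted as part of the arc. -/
def IsArc (E : Set Plane) (U W : Plane) (Γ : Set Plane) : Prop :=
  ∃ γ : ℝ → Plane, ContinuousOn γ (Set.Icc 0 1) ∧ Set.InjOn γ (Set.Icc 0 1) ∧
    Set.MapsTo γ (Set.Icc 0 1) E ∧ γ 0 = U ∧ γ 1 = W ∧ Γ = γ '' Set.Ioo 0 1

end ConicTriad

end

open ConicTriad

/-!
Parametrize the circumcircle by inscribed angles, so that chords have length
`2 * R * |sin (θ - η)|`, and let `φ 0`, `φ 1`, `φ 2` be the parameters of the vertices. The vertices
of the `i`-th P-ellipse of the point `θ` lie on the `i`-th side line at the affine parameters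
`(1 ± κ i) / 2`, where `κ i` is a quotient of sines which, in terms of `t j = tan ((θ - φ j) / 2)`,
equals `(t (i + 1) + t (i + 2)) / (t (i + 1) - t (i + 2))`. Hence, in barycentric coordinates `w`,
all six vertices lie on the two lines `∑ t i * w i = 0` and `∑ w i / t i = 0`. The polar form of any
conic through them agrees, up to a factor, with that of the product of these two linear forms on
all pairs of vertices of the triangle, so there is no other such conic.

The two lines meet at the point with barycentric coordinates `(1 + κ (i + 1) * κ (i + 2)) / 2`,
which are affine functions of `cos (2 * θ)` and `sin (2 * θ)`, so the center moves on an ellipse.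
All this requires `θ - φ j ∈ (0, π)` for each `j`. As the circle determines `φ j` only modulo `π`,
this can be arranged on each of the three arcs between the vertices, but by different choices of
`φ`, and therefore there are three ellipses. They are distinct because the arcs on two of them have
endpoints that are symmetric about the midpoint of a side, which lies on both ellipses, whereas no
ellipse contains the midpoint of two distinct points of it.
-/

namespace ConicTriad

open Real Set

section LinePairs

/-- The union of the zero sets of `f` and `g`. It is a pair of intersecting lines if `f` and `g`
are affine coordinates, i.e. if `f.prod g` is surjective. -/
def linePair (f g : Plane →ᵃ[ℝ] ℝ) : Set Plane := {X | f X * g X = 0}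

lemma exists_affineMap_eq_mul_coords (f : Plane →ᵃ[ℝ] ℝ) :
    ∃ p q r : ℝ, ∀ X, f X = p * X 0 + q * X 1 + r := by
  refine ⟨f.linear (EuclideanSpace.single 0 1), f.linear (EuclideanSpace.single 1 1), f 0,
    fun X => ?_⟩
  have hX : X = X 0 • EuclideanSpace.single 0 1 + X 1 • EuclideanSpace.single 1 1 := by
    ext i
    fin_cases i <;> simp
  have hfX : f X = f.linear X + f 0 := by simpa using f.map_vadd 0 X
  rw [hfX]
  nth_rw 1 [hX]
  simp only [map_add, map_smul, smul_eq_mul]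
  ring

lemma exists_line_eq_zeros (f : Plane →ᵃ[ℝ] ℝ) {O X : Plane} (hO : f O = 0) (hX : f X ≠ 0) :
    ∃ l : AffineSubspace ℝ Plane, Module.finrank ℝ l.direction = 1 ∧
      (l : Set Plane) = {Z | f Z = 0} := by
  have hf : ∀ Z, f Z = f.linear (Z - O) := fun Z => by
    simpa [hO] using (f.linearMap_vsub Z O).symm
  refine ⟨AffineSubspace.mk' O (LinearMap.ker f.linear), ?_, ?_⟩
  · have hlin : f.linear ≠ 0 := fun h => hX (by rw [hf, h, LinearMap.zero_apply])
    have h := Module.Dual.finrank_ker_add_one_of_ne_zero (f := f.linear) hlin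
    rw [finrank_euclideanSpace_fin] at h
    rw [AffineSubspace.direction_mk']
    omega
  · ext Z
    rw [SetLike.mem_coe, AffineSubspace.mem_mk', LinearMap.mem_ker, vsub_eq_sub, ← hf,
      mem_ofPred_eq]

variable {f g : Plane →ᵃ[ℝ] ℝ}

lemma exists_eq_eq_of_surjective_prod (hfg : Function.Surjective (f.prod g)) (x y : ℝ) :
    ∃ X, f X = x ∧ g X = y := by
  obtain ⟨X, hX⟩ := hfg (x, y)
  exact ⟨X, congrArg Prod.fst hX, congrArg Prod.snd hX⟩

lemma isConic_linePair (hfg : Function.Surjective (f.prod g)) : IsConic (linePair f g) := by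
  obtain ⟨p₁, q₁, r₁, hf⟩ := exists_affineMap_eq_mul_coords f
  obtain ⟨p₂, q₂, r₂, hg⟩ := exists_affineMap_eq_mul_coords g
  refine ⟨p₁ * p₂, p₁ * q₂ + p₂ * q₁, q₁ * q₂, p₁ * r₂ + p₂ * r₁, q₁ * r₂ + q₂ * r₁, r₁ * r₂,
    ?_, ?_⟩
  · rintro ⟨ha, hb, hc⟩
    obtain ⟨O, hfO, hgO⟩ := exists_eq_eq_of_surjective_prod hfg 0 0
    obtain ⟨X, hfX, hgX⟩ := exists_eq_eq_of_surjective_prod hfg 1 1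
    rw [hf] at hfO hfX
    rw [hg] at hgO hgX
    have hquad : (p₁ * (X 0 - O 0) + q₁ * (X 1 - O 1)) *
        (p₂ * (X 0 - O 0) + q₂ * (X 1 - O 1)) = 0 := by
      linear_combination (X 0 - O 0) ^ 2 * ha + (X 0 - O 0) * (X 1 - O 1) * hb +
        (X 1 - O 1) ^ 2 * hc
    have hf1 : p₁ * (X 0 - O 0) + q₁ * (X 1 - O 1) = 1 := by linear_combination hfX - hfO
    have hg1 : p₂ * (X 0 - O 0) + q₂ * (X 1 - O 1) = 1 := by linear_combination hgX - hgO
    simp [hf1, hg1] at hquad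
  · ext X
    rw [linePair, mem_ofPred_eq, mem_ofPred_eq, hf, hg]
    constructor <;> intro hX <;> linear_combination hX

lemma isLinePair_linePair (hfg : Function.Surjective (f.prod g)) : IsLinePair (linePair f g) := by
  obtain ⟨O, hfO, hgO⟩ := exists_eq_eq_of_surjective_prod hfg 0 0
  obtain ⟨X, hfX, hgX⟩ := exists_eq_eq_of_surjective_prod hfg 0 1
  obtain ⟨Z, hfZ, -⟩ := exists_eq_eq_of_surjective_prod hfg 1 0
  obtain ⟨l, hl, hlf⟩ := exists_line_eq_zeros f hfO (X := Z) (by simp [hfZ])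
  obtain ⟨m, hm, hmg⟩ := exists_line_eq_zeros g hgO (X := X) (by simp [hgX])
  refine ⟨l, m, hl, hm, ?_, ?_⟩
  · rintro rfl
    have hX : X ∈ (l : Set Plane) := hlf ▸ hfX
    rw [hmg, mem_ofPred_eq, hgX] at hX
    exact one_ne_zero hX
  · ext Z
    rw [hlf, hmg, linePair, mem_ofPred_eq, mem_union, mem_ofPred_eq, mem_ofPred_eq, mul_eq_zero]

lemma affineMap_pointReflection (f : Plane →ᵃ[ℝ] ℝ) (O X : Plane) :
    f (AffineEquiv.pointReflection ℝ O X) = 2 * f O - f X := by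
  rw [AffineEquiv.pointReflection_apply, AffineMap.map_vadd, AffineMap.linearMap_vsub,
    vsub_eq_sub, vadd_eq_add]
  ring

lemma isCenter_linePair_iff (hfg : Function.Surjective (f.prod g)) {O : Plane} :
    IsCenter (linePair f g) O ↔ f O = 0 ∧ g O = 0 := by
  simp only [IsCenter, linePair, mem_ofPred_eq, affineMap_pointReflection]
  constructor
  · intro hO
    constructor
    · obtain ⟨X, hfX, hgX⟩ := exists_eq_eq_of_surjective_prod hfg 0 (2 * g O - 1)
      have hX := hO X (by rw [hfX, zero_mul])
      rw [hfX, hgX] at hX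
      linarith
    · obtain ⟨X, hfX, hgX⟩ := exists_eq_eq_of_surjective_prod hfg (2 * f O - 1) 0
      have hX := hO X (by rw [hgX, mul_zero])
      rw [hfX, hgX] at hX
      linarith
  · rintro ⟨hf, hg⟩ X hX
    rw [hf, hg]
    linarith

end LinePairs

section Conics

/-- The symmetric bi-affine form whose diagonal is the polynomial
`a x ^ 2 + b x y + c y ^ 2 + d x + e y + f`. -/
noncomputable def conicPolar (a b c d e f : ℝ) (X Y : Plane) : ℝ :=
  a * (X 0 * Y 0) + b * (X 0 * Y 1 + X 1 * Y 0) / 2 + c * (X 1 * Y 1) + d * (X 0 + Y 0) / 2 +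
    e * (X 1 + Y 1) / 2 + f

variable {a b c d e f : ℝ}

lemma conicPolar_self (X : Plane) : conicPolar a b c d e f X X =
    a * X 0 ^ 2 + b * X 0 * X 1 + c * X 1 ^ 2 + d * X 0 + e * X 1 + f := by
  simp only [conicPolar]
  ring

lemma conicPolar_comm (X Y : Plane) :
    conicPolar a b c d e f X Y = conicPolar a b c d e f Y X := by
  simp only [conicPolar]
  ring

lemma conicPolar_sum_left {ι : Type*} [Fintype ι] {w : ι → ℝ} (hw : ∑ i, w i = 1)
    (A : ι → Plane) (Y : Plane) :
    conicPolar a b c d e f (∑ i, w i • A i) Y = ∑ i, w i * conicPolar a b c d e f (A i) Y := by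
  have hcoord : ∀ j, (∑ i, w i • A i) j = ∑ i, w i * A i j := fun j => by simp
  have hsplit : ∀ i, w i * conicPolar a b c d e f (A i) Y =
      (w i * A i 0) * (a * Y 0 + b * Y 1 / 2 + d / 2) +
      (w i * A i 1) * (b * Y 0 / 2 + c * Y 1 + e / 2) +
      w i * (d * Y 0 / 2 + e * Y 1 / 2 + f) := fun i => by
    simp only [conicPolar]
    ring
  simp only [hsplit, Finset.sum_add_distrib, ← Finset.sum_mul, hw, ← hcoord]
  simp only [conicPolar]
  ring

lemma conicPolar_self_sum {ι : Type*} [Fintype ι] {w : ι → ℝ} (hw : ∑ i, w i = 1)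
    (A : ι → Plane) :
    conicPolar a b c d e f (∑ i, w i • A i) (∑ i, w i • A i) =
      ∑ i, ∑ j, w i * w j * conicPolar a b c d e f (A i) (A j) := by
  rw [conicPolar_sum_left hw]
  refine Finset.sum_congr rfl fun i _ => ?_
  rw [conicPolar_comm, conicPolar_sum_left hw, Finset.mul_sum]
  exact Finset.sum_congr rfl fun j _ => by rw [conicPolar_comm]; ring

lemma conicPolar_self_lineMap (X Y : Plane) (s : ℝ) :
    conicPolar a b c d e f (AffineMap.lineMap X Y s) (AffineMap.lineMap X Y s) =
      (1 - s) ^ 2 * conicPolar a b c d e f X X + s ^ 2 * conicPolar a b c d e f Y Y +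
        2 * s * (1 - s) * conicPolar a b c d e f X Y := by
  have h := conicPolar_self_sum (a := a) (b := b) (c := c) (d := d) (e := e) (f := f)
    (w := ![1 - s, s]) (by simp) ![X, Y]
  simp only [Fin.sum_univ_two, Matrix.cons_val_zero, Matrix.cons_val_one] at h
  rw [AffineMap.lineMap_apply_module, h, conicPolar_comm Y X]
  ring

lemma conic_leadingCoeffs_eq_zero (h : ∀ X, conicPolar a b c d e f X X = 0) :
    a = 0 ∧ b = 0 ∧ c = 0 := by
  have h00 := h !₂[0, 0]
  have h10 := h !₂[1, 0]
  have h10' := h !₂[-1, 0]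
  have h01 := h !₂[0, 1]
  have h01' := h !₂[0, -1]
  have h11 := h !₂[1, 1]
  simp only [conicPolar_self, Matrix.cons_val_zero, Matrix.cons_val_one] at *
  refine ⟨?_, ?_, ?_⟩ <;> linarith

end Conics

section SymmetricPairs

/-- The pair of points on the line `FG` with affine parameters `(1 ± k) / 2`. It is symmetric
about the midpoint of `FG`, with `k` the ratio of the distance of its points to that of `F`
and `G`. -/
noncomputable def symmPair (F G : Plane) (k : ℝ) : Set Plane :=
  {AffineMap.lineMap F G ((1 - k) / 2), AffineMap.lineMap F G ((1 + k) / 2)}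

lemma eq_or_eq_neg_of_symmPair_eq {F G : Plane} (hFG : F ≠ G) {k k' : ℝ}
    (h : symmPair F G k = symmPair F G k') : k = k' ∨ k = -k' := by
  have hinj := AffineMap.lineMap_injective ℝ hFG
  have hmem : AffineMap.lineMap F G ((1 + k) / 2) ∈ symmPair F G k' := h ▸ Or.inr rfl
  rcases hmem with heq | heq
  · exact Or.inr (by linarith [hinj heq])
  · exact Or.inl (by linarith [hinj heq])

lemma midpoint_lineMap_symm (F G : Plane) (k : ℝ) :
    midpoint ℝ (AffineMap.lineMap F G ((1 + k) / 2)) (AffineMap.lineMap F G ((1 + -k) / 2)) =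
      midpoint ℝ F G := by
  simp only [midpoint_eq_smul_add, invOf_eq_inv, AffineMap.lineMap_apply_module]
  module

lemma symmPair_neg (F G : Plane) (k : ℝ) : symmPair F G (-k) = symmPair F G k := by
  rw [symmPair, sub_neg_eq_add, ← sub_eq_add_neg, pair_comm, symmPair]

lemma symmPair_abs (F G : Plane) (k : ℝ) : symmPair F G |k| = symmPair F G k := by
  rcases abs_choice k with h | h <;> rw [h]
  exact symmPair_neg F G k

lemma abs_add_abs_one_sub_eq_iff {k : ℝ} (hk : 1 < k) (s : ℝ) :
    |s| + |1 - s| = k ↔ s = (1 - k) / 2 ∨ s = (1 + k) / 2 := by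
  constructor
  · intro h
    rcases abs_cases s with ⟨hs, -⟩ | ⟨hs, -⟩ <;>
      rcases abs_cases (1 - s) with ⟨hs', -⟩ | ⟨hs', -⟩ <;>
      first | (left; linarith) | (right; linarith)
  · rintro (rfl | rfl)
    · rw [abs_of_neg (by linarith), abs_of_pos (by linarith)]
      ring
    · rw [abs_of_pos (by linarith), abs_of_neg (by linarith)]
      ring

lemma vertices_eq_symmPair {F G P : Plane} {k : ℝ} (hFG : F ≠ G) (hk : 1 < |k|)
    (hP : dist P F + dist P G = |k| * dist F G) : vertices F G P = symmPair F G k := by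
  have hmem : ∀ s : ℝ, AffineMap.lineMap F G s ∈ ellipseThrough F G P ↔
      s = (1 - |k|) / 2 ∨ s = (1 + |k|) / 2 := fun s => by
    rw [ellipseThrough, focalLocus, mem_ofPred_eq, hP, dist_lineMap_left, dist_lineMap_right,
      ← add_mul, mul_left_inj' (dist_ne_zero.2 hFG), Real.norm_eq_abs, Real.norm_eq_abs,
      abs_add_abs_one_sub_eq_iff hk]
  rw [← symmPair_abs]
  ext X
  simp only [vertices, symmPair, mem_inter_iff, SetLike.mem_coe, mem_insert_iff,
    mem_singleton_iff]
  constructor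
  · rintro ⟨hX, hXl⟩
    obtain ⟨s, rfl⟩ := mem_affineSpan_pair_iff_exists_lineMap_eq.1 hXl
    exact ((hmem s).1 hX).imp (congrArg _) (congrArg _)
  · rintro (rfl | rfl)
    · exact ⟨(hmem _).2 (Or.inl rfl), AffineMap.lineMap_mem_affineSpan_pair _ _ _⟩
    · exact ⟨(hmem _).2 (Or.inr rfl), AffineMap.lineMap_mem_affineSpan_pair _ _ _⟩

lemma conicPolar_of_symmPair_zeros {a b c d e f : ℝ} {F G : Plane} {k : ℝ} (hk : k ≠ 0)
    (h : ∀ X ∈ symmPair F G k, conicPolar a b c d e f X X = 0) :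
    conicPolar a b c d e f F F = conicPolar a b c d e f G G ∧
      (k ^ 2 - 1) * conicPolar a b c d e f F G = (k ^ 2 + 1) * conicPolar a b c d e f G G := by
  have hl := h _ (Or.inl rfl)
  have hr := h _ (Or.inr rfl)
  rw [conicPolar_self_lineMap] at hl hr
  have hdiff : conicPolar a b c d e f F F = conicPolar a b c d e f G G := by
    refine mul_left_cancel₀ hk ?_
    linear_combination hl - hr
  refine ⟨hdiff, ?_⟩
  rw [hdiff] at hl
  linear_combination -2 * hl

end SymmetricPairs

section WeightedCoordinates

lemma sum_fin_three_cyclic {M : Type*} [AddCommMonoid M] (f : Fin 3 → M) (m : Fin 3) :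
    ∑ i, f i = f m + f (m + 1) + f (m + 2) := by
  rw [Fin.sum_univ_three]
  match m with
  | 0 => rfl
  | 1 =>
    change f 0 + f 1 + f 2 = f 1 + f 2 + f 0
    abel
  | 2 =>
    change f 0 + f 1 + f 2 = f 2 + f 0 + f 1
    abel

variable {β : AffineBasis (Fin 3) ℝ Plane} {t κ : Fin 3 → ℝ}

/-- The affine function with the value `t i` at the `i`-th point of the affine basis `β`. -/
noncomputable def weightedCoord (β : AffineBasis (Fin 3) ℝ Plane) (t : Fin 3 → ℝ) :
    Plane →ᵃ[ℝ] ℝ :=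
  ∑ i, t i • β.coord i

lemma weightedCoord_apply (X : Plane) : weightedCoord β t X = ∑ i, t i * β.coord i X := by
  simp [weightedCoord, Fin.sum_univ_three]

lemma weightedCoord_basis (j : Fin 3) : weightedCoord β t (β j) = t j := by
  simp [weightedCoord_apply, β.coord_apply]

lemma weightedCoord_sum {w : Fin 3 → ℝ} (hw : ∑ i, w i = 1) :
    weightedCoord β t (∑ i, w i • β i) = ∑ i, w i * t i := by
  have h := Finset.univ.map_affineCombination β w hw (weightedCoord β t)
  rw [Finset.affineCombination_eq_linear_combination _ _ _ hw,
    Finset.affineCombination_eq_linear_combination _ _ _ hw] at h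
  simpa [weightedCoord_basis] using h

/-- The pair of lines `∑ tᵢ wᵢ = 0` and `∑ wᵢ / tᵢ = 0` in barycentric coordinates `wᵢ`. -/
noncomputable def weightedLinePair (β : AffineBasis (Fin 3) ℝ Plane) (t : Fin 3 → ℝ) : Set Plane :=
  linePair (weightedCoord β t) (weightedCoord β t⁻¹)

lemma weightedCoord_prod_injective (ht0 : ∀ i, t i ≠ 0) (ht : Function.Injective t) :
    Function.Injective ((weightedCoord β t).prod (weightedCoord β t⁻¹)) := by
  intro X Y hXY
  obtain ⟨hf, hg⟩ := Prod.mk.inj hXY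
  refine β.ext_elem fun m => ?_
  have hsum := (β.sum_coord_apply_eq_one X).trans (β.sum_coord_apply_eq_one Y).symm
  simp only [weightedCoord_apply, sum_fin_three_cyclic _ m, Pi.inv_apply] at hf hg hsum
  have h0 := ht0 m
  have h1 := ht0 (m + 1)
  have h2 := ht0 (m + 2)
  field_simp at hg
  have hne1 : t m - t (m + 1) ≠ 0 := sub_ne_zero.2 (ht.ne (by simp))
  have hne2 : t m - t (m + 2) ≠ 0 := sub_ne_zero.2 (ht.ne (by simp))
  refine mul_left_cancel₀ (mul_ne_zero hne1 hne2) ?_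
  linear_combination t m * hf + hg - (t m * t (m + 1) + t m * t (m + 2)) * hsum

lemma weightedCoord_prod_surjective (ht0 : ∀ i, t i ≠ 0) (ht : Function.Injective t) :
    Function.Surjective ((weightedCoord β t).prod (weightedCoord β t⁻¹)) := by
  rw [← AffineMap.linear_surjective_iff,
    ← LinearMap.injective_iff_surjective_of_finrank_eq_finrank (by simp),
    AffineMap.linear_injective_iff]
  exact weightedCoord_prod_injective ht0 ht

lemma neg_mul_inv_sub_inv (ht0 : ∀ i, t i ≠ 0)
    (hκ : ∀ i, κ i * (t (i + 1) - t (i + 2)) = t (i + 1) + t (i + 2)) (i : Fin 3) :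
    (-κ) i * (t⁻¹ (i + 1) - t⁻¹ (i + 2)) = t⁻¹ (i + 1) + t⁻¹ (i + 2) := by
  have h1 := ht0 (i + 1)
  have h2 := ht0 (i + 2)
  simp only [Pi.neg_apply, Pi.inv_apply]
  field_simp
  linear_combination hκ i

lemma weightedCoord_lineMap_eq_zero {i : Fin 3}
    (hκ : κ i * (t (i + 1) - t (i + 2)) = t (i + 1) + t (i + 2)) :
    weightedCoord β t (AffineMap.lineMap (β (i + 1)) (β (i + 2)) ((1 + κ i) / 2)) = 0 := by
  rw [AffineMap.apply_lineMap, weightedCoord_basis, weightedCoord_basis,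
    AffineMap.lineMap_apply_ring']
  linear_combination (-1 / 2) * hκ

lemma symmPair_subset_weightedLinePair (ht0 : ∀ i, t i ≠ 0)
    (hκ : ∀ i, κ i * (t (i + 1) - t (i + 2)) = t (i + 1) + t (i + 2)) (i : Fin 3) :
    symmPair (β (i + 1)) (β (i + 2)) (κ i) ⊆ weightedLinePair β t := by
  have hg := weightedCoord_lineMap_eq_zero (β := β) (neg_mul_inv_sub_inv ht0 hκ i)
  rw [Pi.neg_apply, ← sub_eq_add_neg] at hg
  rintro X (rfl | rfl)
  · exact mul_eq_zero_of_right _ hg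
  · exact mul_eq_zero_of_left (weightedCoord_lineMap_eq_zero (hκ i)) _

variable {a b c d e f : ℝ}

lemma conicPolar_basis (ht0 : ∀ i, 0 < t i)
    (hκ : ∀ i, κ i * (t (i + 1) - t (i + 2)) = t (i + 1) + t (i + 2))
    (h : ∀ i, ∀ X ∈ symmPair (β (i + 1)) (β (i + 2)) (κ i), conicPolar a b c d e f X X = 0)
    (i j : Fin 3) : 2 * t i * t j * conicPolar a b c d e f (β i) (β j) =
      (t i ^ 2 + t j ^ 2) * conicPolar a b c d e f (β 0) (β 0) := by
  have hκ0 : ∀ i, κ i ≠ 0 := fun i h0 => by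
    have := hκ i
    rw [h0, zero_mul] at this
    exact (add_pos (ht0 (i + 1)) (ht0 (i + 2))).ne this
  have hpair := fun i => conicPolar_of_symmPair_zeros (hκ0 i) (h i)
  have hdiag : ∀ i, conicPolar a b c d e f (β i) (β i) = conicPolar a b c d e f (β 0) (β 0)
    | 0 => rfl
    | 1 => (hpair 2).1.symm
    | 2 => (hpair 1).1
  have hoff : ∀ i, 2 * t (i + 1) * t (i + 2) * conicPolar a b c d e f (β (i + 1)) (β (i + 2)) =
      (t (i + 1) ^ 2 + t (i + 2) ^ 2) * conicPolar a b c d e f (β 0) (β 0) := fun i => by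
    have hoff := (hpair i).2
    rw [hdiag] at hoff
    linear_combination (t (i + 1) - t (i + 2)) ^ 2 / 2 * hoff -
      (κ i * (t (i + 1) - t (i + 2)) + t (i + 1) + t (i + 2)) / 2 *
        (conicPolar a b c d e f (β (i + 1)) (β (i + 2)) - conicPolar a b c d e f (β 0) (β 0)) * hκ i
  rcases (by decide +revert : i = j ∨ ∃ m, i = m + 1 ∧ j = m + 2 ∨ i = m + 2 ∧ j = m + 1) with
    rfl | ⟨m, ⟨rfl, rfl⟩ | ⟨rfl, rfl⟩⟩
  · rw [hdiag]
    ring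
  · exact hoff m
  · rw [conicPolar_comm]
    linear_combination hoff m

lemma conicPolar_self_eq_mul_weightedCoord (ht0 : ∀ i, 0 < t i)
    (hκ : ∀ i, κ i * (t (i + 1) - t (i + 2)) = t (i + 1) + t (i + 2))
    (h : ∀ i, ∀ X ∈ symmPair (β (i + 1)) (β (i + 2)) (κ i), conicPolar a b c d e f X X = 0)
    (X : Plane) : conicPolar a b c d e f X X =
      conicPolar a b c d e f (β 0) (β 0) * (weightedCoord β t X * weightedCoord β t⁻¹ X) := by
  set q := conicPolar a b c d e f (β 0) (β 0)
  have hterm : ∀ i j, β.coord i X * β.coord j X * conicPolar a b c d e f (β i) (β j) =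
      q / 2 * ((t i * β.coord i X) * (t⁻¹ j * β.coord j X)) +
        q / 2 * ((t⁻¹ i * β.coord i X) * (t j * β.coord j X)) := fun i j => by
    have hi := (ht0 i).ne'
    have hj := (ht0 j).ne'
    rw [Pi.inv_apply, Pi.inv_apply]
    field_simp
    linear_combination β.coord i X * β.coord j X * conicPolar_basis ht0 hκ h i j
  have hX := conicPolar_self_sum (a := a) (b := b) (c := c) (d := d) (e := e) (f := f)
    (β.sum_coord_apply_eq_one X) β
  rw [β.linear_combination_coord_eq_self] at hX
  rw [hX, weightedCoord_apply, weightedCoord_apply]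
  simp only [hterm, Finset.sum_add_distrib, ← Finset.mul_sum, ← Finset.sum_mul]
  ring

lemma eq_weightedLinePair_of_isConic (ht0 : ∀ i, 0 < t i)
    (hκ : ∀ i, κ i * (t (i + 1) - t (i + 2)) = t (i + 1) + t (i + 2)) {Y : Set Plane}
    (hY : IsConic Y) (h : ∀ i, symmPair (β (i + 1)) (β (i + 2)) (κ i) ⊆ Y) :
    Y = weightedLinePair β t := by
  obtain ⟨a, b, c, d, e, f, hne, rfl⟩ := hY
  simp only [← conicPolar_self] at h ⊢
  have hmul := conicPolar_self_eq_mul_weightedCoord ht0 hκ h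
  have hq : conicPolar a b c d e f (β 0) (β 0) ≠ 0 := fun hq =>
    hne (conic_leadingCoeffs_eq_zero fun X => by rw [hmul, hq, zero_mul])
  ext X
  rw [mem_ofPred_eq, hmul, mul_eq_zero_iff_left hq, weightedLinePair, linePair, mem_ofPred_eq]

lemma center_weight_eq (ht : Function.Injective t)
    (hκ : ∀ i, κ i * (t (i + 1) - t (i + 2)) = t (i + 1) + t (i + 2)) (i : Fin 3) :
    (1 + κ (i + 1) * κ (i + 2)) / 2 =
      t i * (t (i + 1) + t (i + 2)) / ((t (i + 2) - t i) * (t i - t (i + 1))) := by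
  have h1 := hκ (i + 1)
  have h2 := hκ (i + 2)
  simp only [add_assoc, Fin.reduceAdd, add_zero] at h1 h2
  rw [eq_div_iff (mul_ne_zero (sub_ne_zero.2 (ht.ne (by simp))) (sub_ne_zero.2 (ht.ne (by simp))))]
  linear_combination κ (i + 2) * (t i - t (i + 1)) * h1 / 2 + (t (i + 2) + t i) * h2 / 2

lemma weightedCoord_center_eq_zero (ht : Function.Injective t)
    (hκ : ∀ i, κ i * (t (i + 1) - t (i + 2)) = t (i + 1) + t (i + 2)) :
    weightedCoord β t (∑ i, ((1 + κ (i + 1) * κ (i + 2)) / 2) • β i) = 0 := by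
  have hne : ∀ i, t i - t (i + 1) ≠ 0 := fun i => sub_ne_zero.2 (ht.ne (by simp))
  have h01 : t 0 - t 1 ≠ 0 := hne 0
  have h12 : t 1 - t 2 ≠ 0 := hne 1
  have h20 : t 2 - t 0 ≠ 0 := hne 2
  have hsum : ∑ i, (1 + κ (i + 1) * κ (i + 2)) / 2 = 1 := by
    simp only [center_weight_eq ht hκ, Fin.sum_univ_three, Fin.reduceAdd, zero_add]
    field_simp
    ring
  rw [weightedCoord_sum hsum]
  simp only [center_weight_eq ht hκ, Fin.sum_univ_three, Fin.reduceAdd, zero_add]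
  field_simp
  ring

lemma isCenter_weightedLinePair_iff (ht0 : ∀ i, t i ≠ 0) (ht : Function.Injective t)
    (hκ : ∀ i, κ i * (t (i + 1) - t (i + 2)) = t (i + 1) + t (i + 2)) {O : Plane} :
    IsCenter (weightedLinePair β t) O ↔ O = ∑ i, ((1 + κ (i + 1) * κ (i + 2)) / 2) • β i := by
  have hf := weightedCoord_center_eq_zero (β := β) ht hκ
  have hg := weightedCoord_center_eq_zero (β := β) (t := t⁻¹) (κ := -κ) (inv_injective.comp ht)
    (neg_mul_inv_sub_inv ht0 hκ)
  simp only [Pi.neg_apply, neg_mul_neg] at hg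
  rw [weightedLinePair, isCenter_linePair_iff (weightedCoord_prod_surjective ht0 ht)]
  constructor
  · rintro ⟨hfO, hgO⟩
    exact weightedCoord_prod_injective ht0 ht (Prod.ext (hfO.trans hf.symm) (hgO.trans hg.symm))
  · rintro rfl
    exact ⟨hf, hg⟩

end WeightedCoordinates

section ConjugateRadii

open scoped RealInnerProductSpace

lemma exists_cos_eq_sin_eq {x y : ℝ} (h : x ^ 2 + y ^ 2 = 1) : ∃ ψ, cos ψ = x ∧ sin ψ = y := by
  have hz : ‖(⟨x, y⟩ : ℂ)‖ = 1 := by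
    rw [← sq_eq_sq₀ (norm_nonneg _) zero_le_one, Complex.sq_norm, Complex.normSq_mk]
    linarith
  obtain ⟨ψ, hψ⟩ := (Complex.norm_eq_one_iff _).1 hz
  refine ⟨ψ, ?_, ?_⟩
  · simpa [Complex.exp_ofReal_mul_I_re] using congrArg Complex.re hψ
  · simpa [Complex.exp_ofReal_mul_I_im] using congrArg Complex.im hψ

/-- The parametrization, by the eccentric angle, of the ellipse with center `M` and conjugate
semi-diameters `U` and `V`. -/
noncomputable def ellipsePoint (M U V : Plane) (ψ : ℝ) : Plane := M + cos ψ • U + sin ψ • V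

variable {M U V : Plane}

@[fun_prop]
lemma continuous_ellipsePoint : Continuous (ellipsePoint M U V) := by
  unfold ellipsePoint
  fun_prop

lemma ellipsePoint_add_pi_div_two (ψ : ℝ) :
    ellipsePoint 0 U V (ψ + π / 2) = cos ψ • V - sin ψ • U := by
  rw [ellipsePoint, cos_add_pi_div_two, sin_add_pi_div_two]
  module

lemma ellipsePoint_rotate (δ ψ : ℝ) :
    ellipsePoint M (ellipsePoint 0 U V δ) (ellipsePoint 0 U V (δ + π / 2)) ψ =
      ellipsePoint M U V (ψ + δ) := by
  simp only [ellipsePoint_add_pi_div_two]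
  simp only [ellipsePoint, cos_add, sin_add]
  module

lemma range_ellipsePoint_rotate (δ : ℝ) :
    range (ellipsePoint M (ellipsePoint 0 U V δ) (ellipsePoint 0 U V (δ + π / 2))) =
      range (ellipsePoint M U V) := by
  simp only [funext (ellipsePoint_rotate δ)]
  exact (Equiv.addRight δ).surjective.range_comp (ellipsePoint M U V)

lemma linearIndependent_rotate (h : LinearIndependent ℝ ![U, V]) (δ : ℝ) :
    LinearIndependent ℝ ![ellipsePoint 0 U V δ, ellipsePoint 0 U V (δ + π / 2)] := by
  have hδ : ellipsePoint 0 U V (δ + π / 2) = -sin δ • U + cos δ • V := by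
    rw [ellipsePoint_add_pi_div_two]
    module
  rw [hδ, ellipsePoint, zero_add, LinearIndependent.pair_add_smul_add_smul_iff]
  refine ⟨h, fun hdet => ?_⟩
  have := sin_sq_add_cos_sq δ
  nlinarith

lemma exists_principal_radii (U V : Plane) : ∃ δ,
    ⟪ellipsePoint 0 U V δ, ellipsePoint 0 U V (δ + π / 2)⟫ = 0 ∧
      ‖ellipsePoint 0 U V (δ + π / 2)‖ ≤ ‖ellipsePoint 0 U V δ‖ := by
  let g : ℝ → ℝ := fun δ => ⟪ellipsePoint 0 U V δ, ellipsePoint 0 U V (δ + π / 2)⟫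
  have hpi : ∀ δ, ellipsePoint 0 U V (δ + π / 2 + π / 2) = -ellipsePoint 0 U V δ := fun δ => by
    rw [add_assoc, add_halves]
    simp only [ellipsePoint, cos_add_pi, sin_add_pi]
    module
  have hg : ∀ δ, g (δ + π / 2) = -g δ := fun δ => by
    simp only [g, hpi, inner_neg_right, real_inner_comm]
  obtain ⟨δ, hδ⟩ : ∃ δ, g δ = 0 := by
    refine mem_range_of_exists_le_of_exists_ge (by fun_prop) ?_ ?_
    · rcases le_total (g 0) 0 with h | h
      · exact ⟨0, h⟩
      · exact ⟨0 + π / 2, by rw [hg]; linarith⟩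
    · rcases le_total 0 (g 0) with h | h
      · exact ⟨0, h⟩
      · exact ⟨0 + π / 2, by rw [hg]; linarith⟩
  rcases le_total ‖ellipsePoint 0 U V (δ + π / 2)‖ ‖ellipsePoint 0 U V δ‖ with h | h
  · exact ⟨δ, hδ, h⟩
  · exact ⟨δ + π / 2, (hg δ).trans (by rw [hδ, neg_zero]), by rwa [hpi, norm_neg]⟩

lemma exists_eq_add_smul_add_smul (h : LinearIndependent ℝ ![U, V]) (M X : Plane) :
    ∃ x y : ℝ, X = M + x • U + y • V := by
  have hspan := h.span_eq_top_of_card_eq_finrank' (by simp)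
  have hX : X - M ∈ Submodule.span ℝ {U, V} := by
    rw [← Matrix.range_cons_cons_empty U V ![], hspan]
    trivial
  obtain ⟨x, y, hxy⟩ := Submodule.mem_span_pair.1 hX
  exact ⟨x, y, by rw [add_assoc, hxy, add_sub_cancel]⟩

lemma dist_add_smul_sq (horth : ⟪U, V⟫ = 0) (x y e : ℝ) :
    dist (M + x • U + y • V) (M + e • U) ^ 2 = (x - e) ^ 2 * ‖U‖ ^ 2 + y ^ 2 * ‖V‖ ^ 2 := by
  have hsub : M + x • U + y • V - (M + e • U) = (x - e) • U + y • V := by module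
  rw [dist_eq_norm, hsub, norm_add_sq_real, real_inner_smul_left, real_inner_smul_right, horth,
    norm_smul, norm_smul, mul_pow, mul_pow, Real.norm_eq_abs, Real.norm_eq_abs, sq_abs, sq_abs]
  ring

lemma mem_range_ellipsePoint_iff (h : LinearIndependent ℝ ![U, V]) (x y : ℝ) :
    M + x • U + y • V ∈ range (ellipsePoint M U V) ↔ x ^ 2 + y ^ 2 = 1 := by
  constructor
  · rintro ⟨ψ, hψ⟩
    rw [ellipsePoint, add_assoc, add_assoc, add_right_inj] at hψ
    obtain ⟨rfl, rfl⟩ := h.eq_of_pair hψ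
    exact cos_sq_add_sin_sq ψ
  · intro hxy
    obtain ⟨ψ, rfl, rfl⟩ := exists_cos_eq_sin_eq hxy
    exact ⟨ψ, rfl⟩

lemma mem_focalLocus_iff_sq_add_sq (hU : U ≠ 0) (horth : ⟪U, V⟫ = 0) {e : ℝ} (he0 : 0 ≤ e)
    (he1 : e < 1) (hV : ‖V‖ ^ 2 = ‖U‖ ^ 2 * (1 - e ^ 2)) (x y : ℝ) :
    M + x • U + y • V ∈ focalLocus (M + e • U) (M + -e • U) (2 * ‖U‖) ↔ x ^ 2 + y ^ 2 = 1 := by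
  have hUpos : 0 < ‖U‖ := norm_pos_iff.2 hU
  have h₁ := dist_add_smul_sq (M := M) horth x y e
  have h₂ := dist_add_smul_sq (M := M) horth x y (-e)
  rw [hV] at h₁ h₂
  rw [focalLocus, mem_ofPred_eq]
  set d₁ := dist (M + x • U + y • V) (M + e • U)
  set d₂ := dist (M + x • U + y • V) (M + -e • U)
  constructor
  · intro hsum
    have hdiff : d₂ - d₁ = 2 * e * x * ‖U‖ := by
      refine mul_left_cancel₀ (mul_pos two_pos hUpos).ne' ?_
      linear_combination h₂ - h₁ - (d₂ - d₁) * hsum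
    have hd₁ : d₁ = ‖U‖ * (1 - e * x) := by linear_combination (hsum - hdiff) / 2
    have hfactor : ‖U‖ ^ 2 * (1 - e ^ 2) ≠ 0 := by
      refine mul_ne_zero (by positivity) ?_
      nlinarith
    refine mul_left_cancel₀ hfactor ?_
    rw [hd₁] at h₁
    linear_combination -h₁
  · intro hxy
    have hx : |e * x| ≤ 1 := by
      rw [abs_mul, abs_of_nonneg he0]
      exact mul_le_one₀ he1.le (abs_nonneg x) ((sq_le_one_iff_abs_le_one x).1 (by nlinarith))
    obtain ⟨hx₁, hx₂⟩ := abs_le.1 hx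
    have hd₁ : d₁ = ‖U‖ * (1 - e * x) := by
      rw [← sq_eq_sq₀ dist_nonneg (mul_nonneg hUpos.le (by linarith))]
      linear_combination h₁ + ‖U‖ ^ 2 * (1 - e ^ 2) * hxy
    have hd₂ : d₂ = ‖U‖ * (1 + e * x) := by
      rw [← sq_eq_sq₀ dist_nonneg (mul_nonneg hUpos.le (by linarith))]
      linear_combination h₂ + ‖U‖ ^ 2 * (1 - e ^ 2) * hxy
    rw [hd₁, hd₂]
    ring

lemma isEllipse_range_ellipsePoint_of_orthogonal (h : LinearIndependent ℝ ![U, V])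
    (horth : ⟪U, V⟫ = 0) (hle : ‖V‖ ≤ ‖U‖) : IsEllipse (range (ellipsePoint M U V)) := by
  have hU : U ≠ 0 := h.ne_zero 0
  have hUpos : 0 < ‖U‖ := norm_pos_iff.2 hU
  have hVpos : 0 < ‖V‖ := norm_pos_iff.2 (h.ne_zero 1)
  have hratio : (‖V‖ / ‖U‖) ^ 2 ≤ 1 := pow_le_one₀ (by positivity) ((div_le_one hUpos).2 hle)
  have hsq : √(1 - (‖V‖ / ‖U‖) ^ 2) ^ 2 = 1 - (‖V‖ / ‖U‖) ^ 2 := sq_sqrt (by linarith)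
  set e := √(1 - (‖V‖ / ‖U‖) ^ 2)
  have he0 : 0 ≤ e := sqrt_nonneg _
  have he1 : e < 1 := by
    have : 0 < (‖V‖ / ‖U‖) ^ 2 := by positivity
    nlinarith
  have hV : ‖V‖ ^ 2 = ‖U‖ ^ 2 * (1 - e ^ 2) := by
    rw [hsq]
    field_simp
    ring
  refine ⟨M + e • U, M + -e • U, 2 * ‖U‖, ?_, ?_⟩
  · have hsub : M + e • U - (M + -e • U) = (2 * e) • U := by module
    rw [dist_eq_norm, hsub, norm_smul, norm_of_nonneg (by positivity)]
    exact mul_lt_mul_of_pos_right (by linarith) hUpos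
  · ext X
    obtain ⟨x, y, rfl⟩ := exists_eq_add_smul_add_smul h M X
    rw [mem_focalLocus_iff_sq_add_sq hU horth he0 he1 hV, mem_range_ellipsePoint_iff h]

lemma isEllipse_range_ellipsePoint (h : LinearIndependent ℝ ![U, V]) :
    IsEllipse (range (ellipsePoint M U V)) := by
  obtain ⟨δ, horth, hle⟩ := exists_principal_radii U V
  rw [← range_ellipsePoint_rotate δ]
  exact isEllipse_range_ellipsePoint_of_orthogonal (linearIndependent_rotate h δ) horth hle

lemma eq_of_midpoint_mem_range_ellipsePoint (h : LinearIndependent ℝ ![U, V]) {X Y : Plane}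
    (hX : X ∈ range (ellipsePoint M U V)) (hY : Y ∈ range (ellipsePoint M U V))
    (hXY : midpoint ℝ X Y ∈ range (ellipsePoint M U V)) : X = Y := by
  obtain ⟨x, y, rfl⟩ := exists_eq_add_smul_add_smul h M X
  obtain ⟨x', y', rfl⟩ := exists_eq_add_smul_add_smul h M Y
  have hmid : midpoint ℝ (M + x • U + y • V) (M + x' • U + y' • V) =
      M + ((x + x') / 2) • U + ((y + y') / 2) • V := by
    rw [midpoint_eq_smul_add, invOf_eq_inv]
    module
  rw [hmid] at hXY
  rw [mem_range_ellipsePoint_iff h] at hX hY hXY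
  have hx : x = x' := by nlinarith [sq_nonneg (x - x'), sq_nonneg (y - y')]
  have hy : y = y' := by nlinarith [sq_nonneg (x - x'), sq_nonneg (y - y')]
  rw [hx, hy]

lemma eq_of_ellipsePoint_eq (h : LinearIndependent ℝ ![U, V]) {ψ ψ' : ℝ}
    (hψ : |ψ - ψ'| < 2 * π) (heq : ellipsePoint M U V ψ = ellipsePoint M U V ψ') : ψ = ψ' := by
  rw [ellipsePoint, ellipsePoint, add_assoc, add_assoc, add_right_inj] at heq
  obtain ⟨hcos, hsin⟩ := h.eq_of_pair heq
  have hone : cos (ψ - ψ') = 1 := by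
    rw [cos_sub, hcos, hsin, ← sq, ← sq, cos_sq_add_sin_sq]
  obtain ⟨hlt, hgt⟩ := abs_lt.1 hψ
  exact sub_eq_zero.1 ((cos_eq_one_iff_of_lt_of_lt hlt hgt).1 hone)

end ConjugateRadii

lemma isArc_image_Ioo {E : Set Plane} {γ : ℝ → Plane} {a b : ℝ} (hab : a < b)
    (hcont : ContinuousOn γ (Icc a b)) (hinj : InjOn γ (Icc a b)) (hmaps : MapsTo γ (Icc a b) E) :
    IsArc E (γ a) (γ b) (γ '' Ioo a b) := by
  have hIcc : MapsTo (AffineMap.lineMap a b) (Icc (0 : ℝ) 1) (Icc a b) := by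
    rw [← segment_eq_Icc hab.le, segment_eq_image_lineMap]
    exact mapsTo_image _ _
  refine ⟨γ ∘ AffineMap.lineMap a b, hcont.comp (by fun_prop) hIcc,
    hinj.comp (AffineMap.lineMap_injective ℝ hab.ne).injOn hIcc, hmaps.comp hIcc, by simp, by simp,
    ?_⟩
  rw [image_comp, ← openSegment_eq_image_lineMap, openSegment_eq_Ioo hab]

section CenterCurve

/-- If `K` parametrizes a circle by inscribed angles, then the vertices of the ellipse with foci
`K α` and `K β` through `K θ` form the symmetric pair on its axis with this ratio, up to sign;
the sign makes it analytic in `θ`. -/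
noncomputable def axisRatio (α β θ : ℝ) : ℝ := sin (θ - (α + β) / 2) / sin ((β - α) / 2)

lemma axisRatio_sq_sub_one {α β : ℝ} (h : sin ((β - α) / 2) ≠ 0) (θ : ℝ) :
    axisRatio α β θ ^ 2 - 1 = sin (θ - α) * sin (θ - β) / sin ((β - α) / 2) ^ 2 := by
  have hα : θ - α = θ - (α + β) / 2 + (β - α) / 2 := by ring
  have hβ : θ - β = θ - (α + β) / 2 - (β - α) / 2 := by ring
  rw [axisRatio, hα, hβ]
  generalize θ - (α + β) / 2 = x
  generalize (β - α) / 2 = y at h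
  rw [sin_add, sin_sub]
  field_simp
  linear_combination sin y ^ 2 * sin_sq_add_cos_sq x - sin x ^ 2 * sin_sq_add_cos_sq y

lemma axisRatio_add_pi (α β θ : ℝ) : axisRatio α β (θ + π) = -axisRatio α β θ := by
  rw [axisRatio, add_sub_right_comm, sin_add_pi, neg_div, axisRatio]

lemma axisRatio_self_left {α β : ℝ} (h : sin ((β - α) / 2) ≠ 0) : axisRatio α β α = -1 := by
  rw [axisRatio, ← neg_sub, show (α + β) / 2 - α = (β - α) / 2 by ring, sin_neg, neg_div,
    div_self h]

lemma axisRatio_self_right {α β : ℝ} (h : sin ((β - α) / 2) ≠ 0) : axisRatio α β β = 1 := by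
  rw [axisRatio, show β - (α + β) / 2 = (β - α) / 2 by ring, div_self h]

lemma axisRatio_midpoint (α β : ℝ) : axisRatio α β ((α + β) / 2) = 0 := by
  rw [axisRatio, sub_self, sin_zero, zero_div]

lemma axisRatio_mul_sum {α β γ : ℝ} (hα : sin ((γ - β) / 2) ≠ 0) (hβ : sin ((α - γ) / 2) ≠ 0)
    (hγ : sin ((β - α) / 2) ≠ 0) (θ : ℝ) :
    axisRatio β γ θ * axisRatio γ α θ + axisRatio γ α θ * axisRatio α β θ +
      axisRatio α β θ * axisRatio β γ θ = -1 := by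
  have hadd : ∀ x y, θ - (x + y) / 2 = (θ - x) / 2 + (θ - y) / 2 := fun x y => by ring
  have hsub : ∀ x y, (y - x) / 2 = (θ - x) / 2 - (θ - y) / 2 := fun x y => by ring
  simp only [axisRatio, hadd]
  rw [hsub] at hα hβ hγ
  rw [hsub α β, hsub β γ, hsub γ α]
  generalize (θ - α) / 2 = a at *
  generalize (θ - β) / 2 = b at *
  generalize (θ - γ) / 2 = c at *
  field_simp
  simp only [sin_add, sin_sub]
  ring

lemma exists_one_add_axisRatio_mul_div_two_eq (α β α' β' : ℝ) :
    ∃ m, ∀ θ, (1 + axisRatio α β θ * axisRatio α' β' θ) / 2 =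
      m - 1 / (4 * sin ((β - α) / 2) * sin ((β' - α') / 2)) *
        cos (2 * θ - (α + β + α' + β') / 2) := by
  refine ⟨1 / 2 + cos ((α + β) / 2 - (α' + β') / 2) /
    (4 * sin ((β - α) / 2) * sin ((β' - α') / 2)), fun θ => ?_⟩
  have hprod := two_mul_sin_mul_sin (θ - (α + β) / 2) (θ - (α' + β') / 2)
  have hsub : θ - (α + β) / 2 - (θ - (α' + β') / 2) = -((α + β) / 2 - (α' + β') / 2) := by ring
  have hadd : θ - (α + β) / 2 + (θ - (α' + β') / 2) = 2 * θ - (α + β + α' + β') / 2 := by ring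
  rw [hsub, hadd, cos_neg] at hprod
  rw [axisRatio, axisRatio]
  linear_combination hprod / (4 * sin ((β - α) / 2) * sin ((β' - α') / 2))

variable {A : Fin 3 → Plane} {φ : Fin 3 → ℝ}

/-- The position of the center of the six-point conic of `K θ` for the triangle with vertices
`A i = K (φ i)`, where `K` parametrizes the circumcircle by inscribed angles. -/
noncomputable def centerCurve (A : Fin 3 → Plane) (φ : Fin 3 → ℝ) (θ : ℝ) : Plane :=
  ∑ i, ((1 + axisRatio (φ (i + 2)) (φ i) θ * axisRatio (φ i) (φ (i + 1)) θ) / 2) • A i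

lemma centerCurve_eq (hφ : ∀ i, sin ((φ (i + 1) - φ i) / 2) ≠ 0) (θ : ℝ) (i : Fin 3) :
    centerCurve A φ θ = A i +
      ((1 + axisRatio (φ i) (φ (i + 1)) θ * axisRatio (φ (i + 1)) (φ (i + 2)) θ) / 2) •
        (A (i + 1) - A i) +
      ((1 + axisRatio (φ (i + 1)) (φ (i + 2)) θ * axisRatio (φ (i + 2)) (φ i) θ) / 2) •
        (A (i + 2) - A i) := by
  have hi := hφ i
  have hi1 := hφ (i + 1)
  have hi2 := hφ (i + 2)
  simp only [add_assoc, Fin.reduceAdd, add_zero] at hi1 hi2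
  have hsum := axisRatio_mul_sum hi1 hi2 hi θ
  rw [centerCurve, sum_fin_three_cyclic _ i]
  simp only [add_assoc, Fin.reduceAdd, add_zero]
  have hweight : (1 + axisRatio (φ (i + 2)) (φ i) θ * axisRatio (φ i) (φ (i + 1)) θ) / 2 =
      1 - (1 + axisRatio (φ i) (φ (i + 1)) θ * axisRatio (φ (i + 1)) (φ (i + 2)) θ) / 2 -
        (1 + axisRatio (φ (i + 1)) (φ (i + 2)) θ * axisRatio (φ (i + 2)) (φ i) θ) / 2 := by
    linear_combination hsum / 2
  rw [hweight]
  module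

lemma centerCurve_corner (hφ : ∀ i, sin ((φ (i + 1) - φ i) / 2) ≠ 0) (i : Fin 3) :
    centerCurve A φ (φ i) = AffineMap.lineMap (A (i + 1)) (A (i + 2))
      ((1 + axisRatio (φ (i + 1)) (φ (i + 2)) (φ i)) / 2) := by
  have hi2 := hφ (i + 2)
  simp only [add_assoc, Fin.reduceAdd, add_zero] at hi2
  rw [centerCurve_eq hφ _ (i + 1)]
  simp only [add_assoc, Fin.reduceAdd, add_zero]
  rw [axisRatio_self_right hi2, axisRatio_self_left (hφ i), AffineMap.lineMap_apply_module']
  module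

lemma centerCurve_side (hφ : ∀ i, sin ((φ (i + 1) - φ i) / 2) ≠ 0) (i : Fin 3) :
    centerCurve A φ ((φ (i + 1) + φ (i + 2)) / 2) = midpoint ℝ (A (i + 1)) (A (i + 2)) := by
  rw [centerCurve_eq hφ _ i, axisRatio_midpoint, midpoint_eq_smul_add, invOf_eq_inv]
  module

lemma centerCurve_add_pi (θ : ℝ) : centerCurve A φ (θ + π) = centerCurve A φ θ := by
  simp only [centerCurve, axisRatio_add_pi, neg_mul_neg]

lemma linearIndependent_sub_zero (hA : AffineIndependent ℝ A) :
    LinearIndependent ℝ ![A 1 - A 0, A 2 - A 0] := by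
  have h := ((affineIndependent_iff_linearIndependent_vsub ℝ A 0).1 hA).comp
    ![⟨1, by decide⟩, ⟨2, by decide⟩] (by decide)
  have hfun : ![A 1 - A 0, A 2 - A 0] =
      (fun i : {i : Fin 3 // i ≠ 0} => A i -ᵥ A 0) ∘ ![⟨1, by decide⟩, ⟨2, by decide⟩] := by
    funext i
    fin_cases i <;> rfl
  rw [hfun]
  exact h

lemma exists_centerCurve_eq_ellipsePoint (hA : AffineIndependent ℝ A)
    (hφ : ∀ i, sin ((φ (i + 1) - φ i) / 2) ≠ 0) :
    ∃ M U V, LinearIndependent ℝ ![U, V] ∧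
      centerCurve A φ = ellipsePoint M U V ∘ (2 * ·) := by
  have h01 : sin ((φ 1 - φ 0) / 2) ≠ 0 := hφ 0
  have h12 : sin ((φ 2 - φ 1) / 2) ≠ 0 := hφ 1
  have h20 : sin ((φ 0 - φ 2) / 2) ≠ 0 := hφ 2
  obtain ⟨m₁, hm₁⟩ := exists_one_add_axisRatio_mul_div_two_eq (φ 0) (φ 1) (φ 1) (φ 2)
  obtain ⟨m₂, hm₂⟩ := exists_one_add_axisRatio_mul_div_two_eq (φ 1) (φ 2) (φ 2) (φ 0)
  set s₁ := (φ 0 + φ 1 + φ 1 + φ 2) / 2 with hs₁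
  set s₂ := (φ 1 + φ 2 + φ 2 + φ 0) / 2 with hs₂
  set k₁ := 1 / (4 * sin ((φ 1 - φ 0) / 2) * sin ((φ 2 - φ 1) / 2))
  set k₂ := 1 / (4 * sin ((φ 2 - φ 1) / 2) * sin ((φ 0 - φ 2) / 2))
  refine ⟨A 0 + m₁ • (A 1 - A 0) + m₂ • (A 2 - A 0),
    (-k₁ * cos s₁) • (A 1 - A 0) + (-k₂ * cos s₂) • (A 2 - A 0),
    (-k₁ * sin s₁) • (A 1 - A 0) + (-k₂ * sin s₂) • (A 2 - A 0), ?_, funext fun θ => ?_⟩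
  · rw [LinearIndependent.pair_add_smul_add_smul_iff]
    refine ⟨linearIndependent_sub_zero hA, fun hdet => ?_⟩
    have hsin : k₁ * k₂ * sin (s₂ - s₁) = 0 := by
      rw [sin_sub]
      linear_combination hdet
    have hs : s₂ - s₁ = (φ 2 - φ 1) / 2 := by
      rw [hs₁, hs₂]
      ring
    rw [hs] at hsin
    exact mul_ne_zero (mul_ne_zero (by positivity) (by positivity)) h12 hsin
  · rw [centerCurve_eq hφ θ 0]
    simp only [zero_add]
    rw [hm₁, hm₂, cos_sub (2 * θ), cos_sub (2 * θ), Function.comp_apply, ellipsePoint]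
    module

lemma continuous_centerCurve (hA : AffineIndependent ℝ A)
    (hφ : ∀ i, sin ((φ (i + 1) - φ i) / 2) ≠ 0) : Continuous (centerCurve A φ) := by
  obtain ⟨M, U, V, -, h⟩ := exists_centerCurve_eq_ellipsePoint hA hφ
  rw [h]
  fun_prop

lemma eq_of_centerCurve_eq (hA : AffineIndependent ℝ A)
    (hφ : ∀ i, sin ((φ (i + 1) - φ i) / 2) ≠ 0) {θ η : ℝ} (hθη : |θ - η| < π)
    (heq : centerCurve A φ θ = centerCurve A φ η) : θ = η := by
  obtain ⟨M, U, V, hlin, h⟩ := exists_centerCurve_eq_ellipsePoint hA hφ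
  rw [h] at heq
  refine mul_left_cancel₀ two_ne_zero (eq_of_ellipsePoint_eq hlin ?_ heq)
  rw [← mul_sub, abs_mul, abs_two]
  gcongr

lemma exists_range_centerCurve_eq (hA : AffineIndependent ℝ A)
    (hφ : ∀ i, sin ((φ (i + 1) - φ i) / 2) ≠ 0) :
    ∃ M U V, LinearIndependent ℝ ![U, V] ∧
      range (centerCurve A φ) = range (ellipsePoint M U V) := by
  obtain ⟨M, U, V, hlin, h⟩ := exists_centerCurve_eq_ellipsePoint hA hφ
  exact ⟨M, U, V, hlin, by rw [h, (mul_left_surjective₀ two_ne_zero).range_comp]⟩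

lemma isEllipse_range_centerCurve (hA : AffineIndependent ℝ A)
    (hφ : ∀ i, sin ((φ (i + 1) - φ i) / 2) ≠ 0) : IsEllipse (range (centerCurve A φ)) := by
  obtain ⟨M, U, V, hlin, h⟩ := exists_range_centerCurve_eq hA hφ
  exact h ▸ isEllipse_range_ellipsePoint hlin

lemma eq_of_midpoint_mem_range_centerCurve (hA : AffineIndependent ℝ A)
    (hφ : ∀ i, sin ((φ (i + 1) - φ i) / 2) ≠ 0) {X Y : Plane}
    (hX : X ∈ range (centerCurve A φ)) (hY : Y ∈ range (centerCurve A φ))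
    (hXY : midpoint ℝ X Y ∈ range (centerCurve A φ)) : X = Y := by
  obtain ⟨M, U, V, hlin, h⟩ := exists_range_centerCurve_eq hA hφ
  rw [h] at hX hY hXY
  exact eq_of_midpoint_mem_range_ellipsePoint hlin hX hY hXY

end CenterCurve

section InscribedAngles

/-- `K` parametrizes the circle `S` by inscribed angles: the chord from `K θ` to `K η` subtends
the angle `θ - η` (modulo `π`) at the points of `S`, so that `K` winds once around `S` as the
parameter increases by `π`. -/
structure IsInscribedAngleParam (S : EuclideanGeometry.Sphere Plane) (K : ℝ → Plane) : Prop where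
  dist_eq : ∀ θ η, dist (K θ) (K η) = 2 * S.radius * |sin (θ - η)|
  mem_iff : ∀ P, P ∈ S ↔ ∃ θ, K θ = P

variable {S : EuclideanGeometry.Sphere Plane} {K : ℝ → Plane}

lemma exists_isInscribedAngleParam (hS : 0 < S.radius) : ∃ K, IsInscribedAngleParam S K := by
  let e : ℝ → Plane := fun θ => !₂[cos (2 * θ), sin (2 * θ)]
  have hsq : ∀ X Y : Plane, dist X Y ^ 2 = (X 0 - Y 0) ^ 2 + (X 1 - Y 1) ^ 2 := fun X Y => by
    rw [EuclideanSpace.dist_eq, sq_sqrt (by positivity), Fin.sum_univ_two, Real.dist_eq,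
      Real.dist_eq, sq_abs, sq_abs]
  refine ⟨fun θ => S.center + S.radius • e θ, fun θ η => ?_, fun P => ?_⟩
  · have hchord : dist (e θ) (e η) = 2 * |sin (θ - η)| := by
      rw [← sq_eq_sq₀ dist_nonneg (by positivity), hsq, mul_pow, sq_abs]
      simp only [e, Matrix.cons_val_zero, Matrix.cons_val_one]
      have hcos : cos (2 * θ) * cos (2 * η) + sin (2 * θ) * sin (2 * η) =
          1 - 2 * sin (θ - η) ^ 2 := by
        rw [← cos_sub, ← mul_sub, cos_two_mul, cos_sq']
        ring
      linear_combination sin_sq_add_cos_sq (2 * θ) + sin_sq_add_cos_sq (2 * η) - 2 * hcos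
    rw [dist_add_left, dist_smul₀, norm_of_nonneg hS.le, hchord]
    ring
  · have hmem : P ∈ S ↔ ((P 0 - S.center 0) / S.radius) ^ 2 +
        ((P 1 - S.center 1) / S.radius) ^ 2 = 1 := by
      rw [EuclideanGeometry.mem_sphere, ← sq_eq_sq₀ dist_nonneg hS.le, hsq, div_pow, div_pow,
        ← add_div, div_eq_one_iff_eq (pow_pos hS 2).ne']
    rw [hmem]
    constructor
    · intro hP
      obtain ⟨ψ, hcos, hsin⟩ := exists_cos_eq_sin_eq hP
      refine ⟨ψ / 2, ?_⟩
      ext j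
      fin_cases j <;> simp [e, mul_div_cancel₀, hcos, hsin, mul_div_cancel₀, hS.ne']
    · rintro ⟨θ, rfl⟩
      simp [e, hS.ne']

namespace IsInscribedAngleParam

lemma map_add_pi (hK : IsInscribedAngleParam S K) (θ : ℝ) : K (θ + π) = K θ := by
  rw [← dist_eq_zero, hK.dist_eq, add_sub_cancel_left, sin_pi, abs_zero, mul_zero]

lemma comp_neg (hK : IsInscribedAngleParam S K) : IsInscribedAngleParam S (K ∘ Neg.neg) where
  dist_eq θ η := by
    rw [Function.comp_apply, Function.comp_apply, hK.dist_eq, ← neg_sub', sin_neg, abs_neg]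
  mem_iff P := by
    rw [hK.mem_iff]
    exact neg_surjective.exists

lemma exists_eq_of_mem (hK : IsInscribedAngleParam S K) {P : Plane} (hP : P ∈ S) (a : ℝ) :
    ∃ θ ∈ Ico a (a + π), K θ = P := by
  obtain ⟨η, rfl⟩ := (hK.mem_iff P).1 hP
  obtain ⟨θ, hθ, heq⟩ := Function.Periodic.exists_mem_Ico hK.map_add_pi pi_pos η a
  exact ⟨θ, hθ, heq.symm⟩

lemma vertices_eq_symmPair (hK : IsInscribedAngleParam S K) {α β θ : ℝ} (hne : K α ≠ K β)
    (hθ : 0 < sin (θ - α) * sin (θ - β)) :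
    vertices (K α) (K β) (K θ) = symmPair (K α) (K β) (axisRatio α β θ) := by
  have hchord : sin (α - β) = -(2 * sin ((β - α) / 2) * cos ((β - α) / 2)) := by
    rw [← sin_two_mul, ← sin_neg, mul_div_cancel₀ _ two_ne_zero, neg_sub]
  have hhalf : sin ((β - α) / 2) ≠ 0 := fun h => hne <| by
    rw [← dist_eq_zero, hK.dist_eq, hchord, h]
    simp
  refine ConicTriad.vertices_eq_symmPair hne ?_ ?_
  · rw [← one_lt_sq_iff_one_lt_abs, ← sub_pos, axisRatio_sq_sub_one hhalf]
    positivity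
  · have hsum : sin (θ - α) + sin (θ - β) = 2 * sin (θ - (α + β) / 2) * cos ((β - α) / 2) := by
      have hα : θ - α = θ - (α + β) / 2 + (β - α) / 2 := by ring
      have hβ : θ - β = θ - (α + β) / 2 - (β - α) / 2 := by ring
      rw [hα, hβ, sin_add _ ((β - α) / 2), sin_sub _ ((β - α) / 2)]
      ring
    have habs : |sin (θ - α)| + |sin (θ - β)| = |sin (θ - α) + sin (θ - β)| :=
      ((abs_add_eq_add_abs_iff _ _).2 (mul_nonneg_iff.1 hθ.le)).symm
    rw [hK.dist_eq, hK.dist_eq, hK.dist_eq, ← mul_add, habs, hsum, hchord, axisRatio, abs_neg]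
    simp only [abs_mul, abs_div]
    field_simp

end IsInscribedAngleParam

end InscribedAngles

section SixPointConic

lemma exists_inscribed_angles {S : EuclideanGeometry.Sphere Plane} (hS : 0 < S.radius)
    {A : Fin 3 → Plane} (hA : Function.Injective A) (hAS : ∀ i, A i ∈ S) :
    ∃ K, IsInscribedAngleParam S K ∧ ∃ a b c, a < b ∧ b < c ∧ c < a + π ∧
      K a = A 0 ∧ K b = A 1 ∧ K c = A 2 := by
  obtain ⟨K, hK⟩ := exists_isInscribedAngleParam hS
  obtain ⟨a, ha⟩ := (hK.mem_iff _).1 (hAS 0)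
  obtain ⟨b, ⟨hab, hba⟩, hb⟩ := hK.exists_eq_of_mem (hAS 1) a
  obtain ⟨c, ⟨hac, hca⟩, hc⟩ := hK.exists_eq_of_mem (hAS 2) a
  have hab' : a < b := hab.lt_of_ne fun h =>
    hA.ne (by decide : (0 : Fin 3) ≠ 1) (by rw [← ha, h, hb])
  have hac' : a < c := hac.lt_of_ne fun h =>
    hA.ne (by decide : (0 : Fin 3) ≠ 2) (by rw [← ha, h, hc])
  have hbc : b ≠ c := fun h => hA.ne (by decide : (1 : Fin 3) ≠ 2) (by rw [← hb, h, hc])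
  rcases hbc.lt_or_gt with hbc | hcb
  · exact ⟨K, hK, a, b, c, hab', hbc, hca, ha, hb, hc⟩
  · refine ⟨K ∘ Neg.neg, hK.comp_neg, -a - π, -b, -c, by linarith, by linarith, by linarith, ?_,
      ?_, ?_⟩
    · rw [Function.comp_apply, neg_sub, sub_neg_eq_add, add_comm, hK.map_add_pi, ha]
    · rw [Function.comp_apply, neg_neg, hb]
    · rw [Function.comp_apply, neg_neg, hc]

lemma sin_half_sub_ne_zero {x y : ℝ} (hne : x ≠ y) (h : |x - y| < 2 * π) :
    sin ((x - y) / 2) ≠ 0 := by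
  obtain ⟨hlo, hhi⟩ := abs_lt.1 h
  rw [Ne, sin_eq_zero_iff_of_lt_of_lt (by linarith) (by linarith), div_eq_zero_iff, sub_eq_zero]
  simpa using hne

lemma axisRatio_mul_tan_sub_tan {α β θ : ℝ} (hα : cos ((θ - α) / 2) ≠ 0)
    (hβ : cos ((θ - β) / 2) ≠ 0) (hαβ : sin ((β - α) / 2) ≠ 0) :
    axisRatio α β θ * (tan ((θ - α) / 2) - tan ((θ - β) / 2)) =
      tan ((θ - α) / 2) + tan ((θ - β) / 2) := by
  have hadd : θ - (α + β) / 2 = (θ - α) / 2 + (θ - β) / 2 := by ring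
  have hsub : (β - α) / 2 = (θ - α) / 2 - (θ - β) / 2 := by ring
  rw [axisRatio, tan_eq_sin_div_cos, tan_eq_sin_div_cos, hadd, hsub]
  rw [hsub] at hαβ
  generalize (θ - α) / 2 = x at *
  generalize (θ - β) / 2 = y at *
  field_simp
  rw [sin_add, sin_sub]
  ring

variable {T : Affine.Triangle ℝ Plane} {K : ℝ → Plane} {φ : Fin 3 → ℝ} {θ : ℝ}

/-- The vertices of a triangle, as the reference points of barycentric coordinates. -/
noncomputable def triangleBasis (T : Affine.Triangle ℝ Plane) : AffineBasis (Fin 3) ℝ Plane :=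
  ⟨T.points, T.independent,
    (T.independent.affineSpan_eq_top_iff_card_eq_finrank_add_one).2 (by simp)⟩

lemma pEllipseVertices_eq_symmPair (hK : IsInscribedAngleParam T.circumsphere K)
    (hφ : ∀ j, K (φ j) = T.points j) {i : Fin 3}
    (hθ : 0 < sin (θ - φ (i + 1)) * sin (θ - φ (i + 2))) :
    pEllipseVertices T (K θ) i = symmPair (T.points (i + 1)) (T.points (i + 2))
      (axisRatio (φ (i + 1)) (φ (i + 2)) θ) := by
  have hne : K (φ (i + 1)) ≠ K (φ (i + 2)) := by
    rw [hφ, hφ]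
    exact T.independent.injective.ne (by simp)
  rw [pEllipseVertices, ← hφ, ← hφ, hK.vertices_eq_symmPair hne hθ]

lemma exists_weights (hφ : Function.Injective φ) (hθ : ∀ j, θ - φ j ∈ Ioo 0 π) :
    ∃ t : Fin 3 → ℝ, (∀ i, 0 < t i) ∧ Function.Injective t ∧
      ∀ i, axisRatio (φ (i + 1)) (φ (i + 2)) θ * (t (i + 1) - t (i + 2)) =
      t (i + 1) + t (i + 2) := by
  have hhalf : ∀ j, (θ - φ j) / 2 ∈ Ioo 0 (π / 2) := fun j =>
    ⟨half_pos (hθ j).1, div_lt_div_of_pos_right (hθ j).2 two_pos⟩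
  have hcos : ∀ j, cos ((θ - φ j) / 2) ≠ 0 := fun j =>
    (cos_pos_of_mem_Ioo ⟨by linarith [(hhalf j).1, pi_pos], (hhalf j).2⟩).ne'
  refine ⟨fun j => tan ((θ - φ j) / 2),
    fun j => tan_pos_of_pos_of_lt_pi_div_two (hhalf j).1 (hhalf j).2,
    fun j k hjk => ?_, fun i => axisRatio_mul_tan_sub_tan (hcos _) (hcos _) ?_⟩
  · have h := injOn_tan ⟨by linarith [(hhalf j).1, pi_pos], (hhalf j).2⟩
      ⟨by linarith [(hhalf k).1, pi_pos], (hhalf k).2⟩ hjk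
    exact hφ (by linarith)
  · refine sin_half_sub_ne_zero (hφ.ne (by simp)) (abs_lt.2 ⟨?_, ?_⟩) <;>
      linarith [(hθ (i + 1)).1, (hθ (i + 1)).2, (hθ (i + 2)).1, (hθ (i + 2)).2]

lemma exists_isSixPointConic_iff (hK : IsInscribedAngleParam T.circumsphere K)
    (hφ : ∀ j, K (φ j) = T.points j) (hθ : ∀ j, θ - φ j ∈ Ioo 0 π) :
    ∃ Y₀, IsLinePair Y₀ ∧ (∀ O, IsCenter Y₀ O ↔ O = centerCurve T.points φ θ) ∧
      ∀ Y, IsSixPointConic T (K θ) Y ↔ Y = Y₀ := by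
  have hinj : Function.Injective φ := fun j k hjk =>
    T.independent.injective (by rw [← hφ, hjk, hφ])
  have hsin : ∀ j, 0 < sin (θ - φ j) := fun j => sin_pos_of_mem_Ioo (hθ j)
  obtain ⟨t, ht0, ht, hκ⟩ := exists_weights hinj hθ
  have ht0' : ∀ i, t i ≠ 0 := fun i => (ht0 i).ne'
  have hvert := fun i => pEllipseVertices_eq_symmPair hK hφ (mul_pos (hsin (i + 1)) (hsin (i + 2)))
  have hprod := weightedCoord_prod_surjective (β := triangleBasis T) ht0' ht
  refine ⟨weightedLinePair (triangleBasis T) t, isLinePair_linePair hprod, fun O => ?_, fun Y => ?_⟩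
  · rw [isCenter_weightedLinePair_iff ht0' ht hκ, centerCurve]
    simp only [add_assoc, Fin.reduceAdd, add_zero]
    rfl
  · simp only [IsSixPointConic, hvert]
    constructor
    · rintro ⟨hY, h⟩
      exact eq_weightedLinePair_of_isConic ht0 hκ hY h
    · rintro rfl
      exact ⟨isConic_linePair hprod,
        symmPair_subset_weightedLinePair (β := triangleBasis T) ht0' hκ⟩

end SixPointConic

section Arcs

/-- `φ` gives the inscribed-angle parameters of the vertices of `T`, normalized for the arc of the
circumcircle opposite to the `i`-th vertex: on that arc, `θ` runs from `φ (i + 1)` to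
`φ (i + 2) + π`, which are the `θ` with `θ - φ j ∈ (0, π)` for all `j`. -/
structure IsArcChart (T : Affine.Triangle ℝ Plane) (K : ℝ → Plane) (i : Fin 3)
    (φ : Fin 3 → ℝ) : Prop where
  map_eq : ∀ j, K (φ j) = T.points j
  right_lt_opposite : φ (i + 2) < φ i
  opposite_lt_left : φ i < φ (i + 1)
  left_lt_right_add_pi : φ (i + 1) < φ (i + 2) + π

variable {T : Affine.Triangle ℝ Plane} {K : ℝ → Plane} {φ φ' : Fin 3 → ℝ} {i : Fin 3}

lemma fin_three_eq_or_eq_add_one_or_eq_add_two (i j : Fin 3) :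
    j = i ∨ j = i + 1 ∨ j = i + 2 := by
  decide +revert

namespace IsArcChart

lemma sub_mem_Ioo (h : IsArcChart T K i φ) {θ : ℝ}
    (hθ : θ ∈ Ioo (φ (i + 1)) (φ (i + 2) + π)) (j : Fin 3) : θ - φ j ∈ Ioo 0 π := by
  have h1 := h.right_lt_opposite
  have h2 := h.opposite_lt_left
  obtain ⟨hlo, hhi⟩ := hθ
  rcases fin_three_eq_or_eq_add_one_or_eq_add_two i j with rfl | rfl | rfl <;>
    constructor <;> linarith

lemma map_mem_admissible (hK : IsInscribedAngleParam T.circumsphere K) (h : IsArcChart T K i φ)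
    {θ : ℝ} (hθ : θ ∈ Ioo (φ (i + 1)) (φ (i + 2) + π)) : K θ ∈ admissible T := by
  refine ⟨(hK.mem_iff _).2 ⟨θ, rfl⟩, ?_⟩
  rintro ⟨j, hj⟩
  have hdist := hK.dist_eq θ (φ j)
  rw [h.map_eq, hj, dist_self] at hdist
  have hsin := sin_pos_of_mem_Ioo (h.sub_mem_Ioo hθ j)
  exact (mul_pos (mul_pos two_pos T.circumradius_pos) (abs_pos.2 hsin.ne')).ne hdist

lemma sin_half_ne_zero (h : IsArcChart T K i φ) (j : Fin 3) :
    sin ((φ (j + 1) - φ j) / 2) ≠ 0 := by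
  have h1 := h.right_lt_opposite
  have h2 := h.opposite_lt_left
  have h3 := h.left_lt_right_add_pi
  rcases fin_three_eq_or_eq_add_one_or_eq_add_two i j with rfl | rfl | rfl
  · exact sin_half_sub_ne_zero h2.ne' (abs_lt.2 ⟨by linarith, by linarith⟩)
  · simpa only [add_assoc, Fin.reduceAdd] using
      sin_half_sub_ne_zero (h1.trans h2).ne (abs_lt.2 ⟨by linarith, by linarith⟩)
  · simpa only [add_assoc, Fin.reduceAdd, add_zero] using
      sin_half_sub_ne_zero h1.ne' (abs_lt.2 ⟨by linarith, by linarith⟩)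

lemma vEllipseVertices_left (hK : IsInscribedAngleParam T.circumsphere K)
    (h : IsArcChart T K i φ) : vEllipseVertices T (i + 1) = symmPair (T.points (i + 2)) (T.points i)
      (axisRatio (φ (i + 2)) (φ i) (φ (i + 1))) := by
  have h1 := h.right_lt_opposite
  have h2 := h.opposite_lt_left
  have h3 := h.left_lt_right_add_pi
  have hpos : 0 < sin (φ (i + 1) - φ (i + 2)) * sin (φ (i + 1) - φ i) :=
    mul_pos (sin_pos_of_mem_Ioo ⟨by linarith, by linarith⟩)
      (sin_pos_of_mem_Ioo ⟨by linarith, by linarith⟩)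
  have hvert := pEllipseVertices_eq_symmPair (i := i + 1) (θ := φ (i + 1)) hK h.map_eq
  simp only [add_assoc, Fin.reduceAdd, add_zero] at hvert
  rw [← hvert hpos, h.map_eq]
  rfl

lemma vEllipseVertices_right (hK : IsInscribedAngleParam T.circumsphere K)
    (h : IsArcChart T K i φ) : vEllipseVertices T (i + 2) = symmPair (T.points i) (T.points (i + 1))
      (axisRatio (φ i) (φ (i + 1)) (φ (i + 2))) := by
  have h1 := h.right_lt_opposite
  have h2 := h.opposite_lt_left
  have h3 := h.left_lt_right_add_pi
  have hpos : 0 < sin (φ (i + 2) - φ i) * sin (φ (i + 2) - φ (i + 1)) :=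
    mul_pos_of_neg_of_neg (sin_neg_of_neg_of_neg_pi_lt (by linarith) (by linarith))
      (sin_neg_of_neg_of_neg_pi_lt (by linarith) (by linarith))
  have hvert := pEllipseVertices_eq_symmPair (i := i + 2) (θ := φ (i + 2)) hK h.map_eq
  simp only [add_assoc, Fin.reduceAdd, add_zero] at hvert
  rw [← hvert hpos, h.map_eq]
  rfl

lemma centerCurve_left (h : IsArcChart T K i φ) : centerCurve T.points φ (φ (i + 1)) =
    AffineMap.lineMap (T.points (i + 2)) (T.points i)
      ((1 + axisRatio (φ (i + 2)) (φ i) (φ (i + 1))) / 2) := by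
  have hcorner := centerCurve_corner (A := T.points) h.sin_half_ne_zero (i + 1)
  simpa only [add_assoc, Fin.reduceAdd, add_zero] using hcorner

lemma centerCurve_right (h : IsArcChart T K i φ) : centerCurve T.points φ (φ (i + 2) + π) =
    AffineMap.lineMap (T.points i) (T.points (i + 1))
      ((1 + axisRatio (φ i) (φ (i + 1)) (φ (i + 2))) / 2) := by
  have hcorner := centerCurve_corner (A := T.points) h.sin_half_ne_zero (i + 2)
  rw [centerCurve_add_pi]
  simpa only [add_assoc, Fin.reduceAdd, add_zero] using hcorner

lemma centerCurve_left_mem_vEllipseVertices (hK : IsInscribedAngleParam T.circumsphere K)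
    (h : IsArcChart T K i φ) :
    centerCurve T.points φ (φ (i + 1)) ∈ vEllipseVertices T (i + 1) := by
  rw [h.vEllipseVertices_left hK, h.centerCurve_left]
  exact Or.inr rfl

lemma centerCurve_right_mem_vEllipseVertices (hK : IsInscribedAngleParam T.circumsphere K)
    (h : IsArcChart T K i φ) :
    centerCurve T.points φ (φ (i + 2) + π) ∈ vEllipseVertices T (i + 2) := by
  rw [h.vEllipseVertices_right hK, h.centerCurve_right]
  exact Or.inr rfl

lemma axisRatio_left_pos (h : IsArcChart T K i φ) :
    0 < axisRatio (φ (i + 2)) (φ i) (φ (i + 1)) := by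
  have h1 := h.right_lt_opposite
  have h2 := h.opposite_lt_left
  have h3 := h.left_lt_right_add_pi
  exact div_pos (sin_pos_of_mem_Ioo ⟨by linarith, by linarith⟩)
    (sin_pos_of_mem_Ioo ⟨by linarith, by linarith⟩)

lemma axisRatio_right_neg (h : IsArcChart T K i φ) :
    axisRatio (φ i) (φ (i + 1)) (φ (i + 2)) < 0 := by
  have h1 := h.right_lt_opposite
  have h2 := h.opposite_lt_left
  have h3 := h.left_lt_right_add_pi
  exact div_neg_of_neg_of_pos (sin_neg_of_neg_of_neg_pi_lt (by linarith) (by linarith))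
    (sin_pos_of_mem_Ioo ⟨by linarith, by linarith⟩)

lemma isArc_centerCurve (h : IsArcChart T K i φ) :
    IsArc (range (centerCurve T.points φ)) (centerCurve T.points φ (φ (i + 1)))
      (centerCurve T.points φ (φ (i + 2) + π))
      (centerCurve T.points φ '' Ioo (φ (i + 1)) (φ (i + 2) + π)) := by
  have h1 := h.right_lt_opposite
  have h2 := h.opposite_lt_left
  refine isArc_image_Ioo h.left_lt_right_add_pi
    (continuous_centerCurve T.independent h.sin_half_ne_zero).continuousOn
    (fun θ hθ η hη => ?_) (fun θ _ => mem_range_self θ)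
  refine eq_of_centerCurve_eq T.independent h.sin_half_ne_zero (abs_lt.2 ⟨?_, ?_⟩) <;>
    linarith [hθ.1, hθ.2, hη.1, hη.2]

lemma range_centerCurve_ne (hK : IsInscribedAngleParam T.circumsphere K)
    (h : IsArcChart T K i φ) (h' : IsArcChart T K (i + 1) φ') :
    range (centerCurve T.points φ) ≠ range (centerCurve T.points φ') := by
  have hκ := h.axisRatio_right_neg
  have hκ' := h'.axisRatio_left_pos
  have hV := h.vEllipseVertices_right hK
  have hV' := h'.vEllipseVertices_left hK
  have hX := h.centerCurve_right
  have hX' := h'.centerCurve_left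
  have hM := centerCurve_side (A := T.points) h.sin_half_ne_zero (i + 2)
  simp only [add_assoc, Fin.reduceAdd, add_zero] at hκ' hV' hX' hM
  generalize axisRatio (φ i) (φ (i + 1)) (φ (i + 2)) = κ at hκ hV hX
  generalize axisRatio (φ' i) (φ' (i + 1)) (φ' (i + 2)) = κ' at hκ' hV' hX'
  have hne : T.points i ≠ T.points (i + 1) := T.independent.injective.ne (by simp)
  obtain rfl : κ' = -κ := by
    rcases eq_or_eq_neg_of_symmPair_eq hne (hV'.symm.trans hV) with rfl | hneg
    · linarith
    · exact hneg
  intro heq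
  have hend := eq_of_midpoint_mem_range_centerCurve T.independent h.sin_half_ne_zero ⟨_, hX⟩
    (heq ▸ ⟨_, hX'⟩) ⟨_, hM.trans (midpoint_lineMap_symm _ _ κ).symm⟩
  linarith [AffineMap.lineMap_injective ℝ hne hend]

end IsArcChart

lemma exists_isArcChart (T : Affine.Triangle ℝ Plane) :
    ∃ (K : ℝ → Plane) (Φ : Fin 3 → Fin 3 → ℝ), IsInscribedAngleParam T.circumsphere K ∧
      (∀ i, IsArcChart T K i (Φ i)) ∧
      admissible T = ⋃ i, K '' Ioo (Φ i (i + 1)) (Φ i (i + 2) + π) := by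
  obtain ⟨K, hK, a, b, c, hab, hbc, hca, ha, hb, hc⟩ :=
    exists_inscribed_angles T.circumradius_pos T.independent.injective T.mem_circumsphere
  have hc' : K (c - π) = T.points 2 := by rw [← hK.map_add_pi, sub_add_cancel, hc]
  have ha' : K (a + π) = T.points 0 := by rw [hK.map_add_pi, ha]
  have h0 : IsArcChart T K 0 ![a, b, c - π] :=
    ⟨fun j => by fin_cases j <;> assumption, sub_lt_iff_lt_add.2 hca, hab,
      hbc.trans_eq (sub_add_cancel c π).symm⟩
  have h1 : IsArcChart T K 1 ![a, b, c] :=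
    ⟨fun j => by fin_cases j <;> assumption, hab, hbc, hca⟩
  have h2 : IsArcChart T K 2 ![a + π, b, c] :=
    ⟨fun j => by fin_cases j <;> assumption, hbc, hca, add_lt_add_left hab π⟩
  have hΦ : ∀ i, IsArcChart T K i (![![a, b, c - π], ![a, b, c], ![a + π, b, c]] i) := fun i => by
    fin_cases i <;> assumption
  refine ⟨K, _, hK, hΦ, Subset.antisymm ?_ ?_⟩
  · rintro P ⟨hPS, hPT⟩
    obtain ⟨θ, ⟨hbθ, hθb⟩, rfl⟩ := hK.exists_eq_of_mem hPS b
    have hne : θ ≠ b ∧ θ ≠ c ∧ θ ≠ a + π := by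
      refine ⟨?_, ?_, ?_⟩ <;> rintro rfl
      exacts [hPT ⟨1, hb.symm⟩, hPT ⟨2, hc.symm⟩, hPT ⟨0, ha'.symm⟩]
    obtain ⟨hθb', hθc, hθa⟩ := hne
    have hbθ := hbθ.lt_of_ne hθb'.symm
    rw [mem_iUnion]
    rcases hθc.lt_or_gt with hθc | hcθ
    · exact ⟨0, θ, ⟨hbθ, hθc.trans_eq (sub_add_cancel c π).symm⟩, rfl⟩
    · rcases hθa.lt_or_gt with hθa | haθ
      · exact ⟨1, θ, ⟨hcθ, hθa⟩, rfl⟩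
      · exact ⟨2, θ, ⟨haθ, hθb⟩, rfl⟩
  · exact iUnion_subset fun i => image_subset_iff.2 fun θ hθ => (hΦ i).map_mem_admissible hK hθ

lemma existsUnique_isSixPointConic {P : Plane} (hP : P ∈ admissible T) :
    (∃! Y, IsSixPointConic T P Y) ∧
      ∀ Y, IsSixPointConic T P Y → IsLinePair Y ∧ ∃! O, IsCenter Y O := by
  obtain ⟨K, Φ, hK, hΦ, hadm⟩ := exists_isArcChart T
  rw [hadm, mem_iUnion] at hP
  obtain ⟨i, θ, hθ, rfl⟩ := hP
  obtain ⟨Y₀, hpair, hO, hY⟩ :=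
    exists_isSixPointConic_iff hK (hΦ i).map_eq ((hΦ i).sub_mem_Ioo hθ)
  simp only [hY, forall_eq, hO, existsUnique_eq, and_self, hpair]

lemma injective_range_centerCurve (hK : IsInscribedAngleParam T.circumsphere K)
    {Φ : Fin 3 → Fin 3 → ℝ} (hΦ : ∀ i, IsArcChart T K i (Φ i)) :
    Function.Injective fun i => range (centerCurve T.points (Φ i)) := by
  intro i j hij
  have hne := fun m => (hΦ m).range_centerCurve_ne hK (hΦ (m + 1))
  rcases fin_three_eq_or_eq_add_one_or_eq_add_two i j with rfl | rfl | rfl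
  · rfl
  · exact absurd hij (hne i)
  · have hne2 := hne (i + 2)
    simp only [add_assoc, Fin.reduceAdd, add_zero] at hne2
    exact absurd hij.symm hne2

lemma centerLocus_eq_iUnion (hK : IsInscribedAngleParam T.circumsphere K)
    {Φ : Fin 3 → Fin 3 → ℝ} (hΦ : ∀ i, IsArcChart T K i (Φ i))
    (hadm : admissible T = ⋃ i, K '' Ioo (Φ i (i + 1)) (Φ i (i + 2) + π)) :
    centerLocus T =
      ⋃ i, centerCurve T.points (Φ i) '' Ioo (Φ i (i + 1)) (Φ i (i + 2) + π) := by
  have hcenter : ∀ i, ∀ θ ∈ Ioo (Φ i (i + 1)) (Φ i (i + 2) + π), ∀ O,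
      (∃ Y, IsSixPointConic T (K θ) Y ∧ IsCenter Y O) ↔ O = centerCurve T.points (Φ i) θ := by
    intro i θ hθ O
    obtain ⟨Y₀, -, hO, hY⟩ :=
      exists_isSixPointConic_iff hK (hΦ i).map_eq ((hΦ i).sub_mem_Ioo hθ)
    simp only [hY, exists_eq_left, hO]
  ext O
  simp only [centerLocus, hadm, mem_ofPred_eq, mem_iUnion, mem_image]
  constructor
  · rintro ⟨_, ⟨i, θ, hθ, rfl⟩, hO⟩
    exact ⟨i, θ, hθ, ((hcenter i θ hθ O).1 hO).symm⟩
  · rintro ⟨i, θ, hθ, rfl⟩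
    exact ⟨K θ, ⟨i, θ, hθ, rfl⟩, (hcenter i θ hθ _).2 rfl⟩

end Arcs

end ConicTriad

theorem mainTheorem5 (T : Affine.Triangle ℝ Plane) :
    -- the six-point conic and its center are well defined, and the conic is degenerate
    (∀ P ∈ admissible T, (∃! Y, IsSixPointConic T P Y) ∧
      ∀ Y, IsSixPointConic T P Y → IsLinePair Y ∧ ∃! O, IsCenter Y O) ∧
    -- the locus of the center
    ∃ L Γ : Fin 3 → Set Plane,
      (∀ i, IsEllipse (L i)) ∧
      Function.Injective L ∧
      (∀ i j : Fin 3, midpoint ℝ (T.points (j + 1)) (T.points (j + 2)) ∈ L i) ∧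
      (∀ i : Fin 3, ∃ U ∈ vEllipseVertices T (i + 1), ∃ W ∈ vEllipseVertices T (i + 2),
        IsArc (L i) U W (Γ i)) ∧
      centerLocus T = ⋃ i, Γ i := by
  obtain ⟨K, Φ, hK, hΦ, hadm⟩ := exists_isArcChart T
  refine ⟨fun P => existsUnique_isSixPointConic,
    fun i => Set.range (centerCurve T.points (Φ i)),
    fun i => centerCurve T.points (Φ i) '' Set.Ioo (Φ i (i + 1)) (Φ i (i + 2) + Real.pi),
    fun i => isEllipse_range_centerCurve T.independent (hΦ i).sin_half_ne_zero,
    injective_range_centerCurve hK hΦ,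
    fun i j => ⟨_, centerCurve_side (hΦ i).sin_half_ne_zero j⟩,
    fun i => ⟨_, (hΦ i).centerCurve_left_mem_vEllipseVertices hK, _,
      (hΦ i).centerCurve_right_mem_vEllipseVertices hK, (hΦ i).isArc_centerCurve⟩,
    centerLocus_eq_iUnion hK hΦ hadm⟩
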